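/- Finite partially ordered sets are regarded as finite $T_0$ spaces whose open sets are the lower sets; continuous maps are then the order-preserving maps. $HTop$ is the homotopy category of topological spaces. In pro-$HTop$ the objects are inverse systems in $HTop$; a morphism $(X_\lambda)\to(Y_\mu)$ is represented by an index function $\phi$ and morphisms $f_\mu:X_{\phi(\mu)}\to Y_\mu$ that are compatible with the bonding morphisms after restriction to some large index, and two such families are identified if, for each $\mu$, their $\mu$-th components agree after restriction to some large index. **FASO.** Let $(X,d)$ be a compact metric space. A finite set $A\subseteq X$ is an $\epsilon$-approximation if every $x\in X$ satisfies $d(x,a)<\epsilon$ for some $a\in A$. Let $\mathcal U_r(A)$ be the set of nonempty $C\subseteq A$ with $\operatorname{diam}(C)<r$, ordered by $C\le D$ iff $D\subseteq C$. A FASO of $X$ is an inverse sequence $(\mathcal U_{4\epsilon_n}(A_n),q_{n,n+1})_{n\ge 0}$, where $\epsilon_n>0$ decreases strictly to $0$, $A_n$ is an $\epsilon_n$-approximation of $X$, $\epsilon_{n+1}<\frac{1}{2}\bigl(\epsilon_n-\sup_{x\in X}d(x,A_n)\bigr)$, and $q_{n,n+1}(C)=\bigcup_{x\in C}\mathcal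 B(x,\epsilon_n)\cap A_n$, with $\mathcal B$ denoting open balls. **Clader's sequence.** Let $K$ be a finite geometric simplicial complex. Let $X^0$ be the poset of (nonempty) faces of $K$ ordered by reverse inclusion, let $X^{m+1}$ be the set of nonempty finite chains of $X^m$ ordered by reverse inclusion, and let $h_{m,m+1}:X^{m+1}\to X^m$ send $x_1<\dots<x_k$ to $x_1$. An element $s$ of $X^m$ is a simplex of the $m$-th barycentric subdivision of $K$; let $V(s)\subseteq|K|$ be its set of vertices. **Theorem.** Let $K$ be a finite polyhedron, that is, the space $|K|$ of a finite simplicial complex in a real normed space, with a metric inducing its topology, and let $(\mathcal U_{4\epsilon_n}(A_n),q_{n,n+1})$ be a FASO of $|K|$. There is a natural morphism from $(X^m,h_{m,m+1})$ to $(\mathcal U_{4\epsilon_n}(A_n),q_{n,n+1})$ in pro-$HTop$, in the following sense. 1. There is exactly one morphism $F:(X^m,h_{m,m+1})\to(\mathcal U_{4\epsilon_n}(A_n),q_{n,n+1})$ in pro-$HTop$ such that, for every $n$ and all sufficiently large $m$, the formula $i(s)=\bigcup_{v\in V(s)}\mathcal B(v,\epsilon_n)\cap A_n$ defines a continuous map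 $i:X^m\to\mathcal U_{4\epsilon_n}(A_n)$ whose homotopy class represents the $n$-th component of $F$. 2. There are $t_0<t_1<\cdots$ such that for every $n$ this formula defines a continuous map $i_n:X^{t_n}\to\mathcal U_{4\epsilon_n}(A_n)$, the homotopy classes of the $i_n$ form a level morphism $(i_n,\mathrm{id}):(X^{t_n},h_{t_n,t_{n+1}})\to(\mathcal U_{4\epsilon_n}(A_n),q_{n,n+1})$ (that is, $i_n\circ h_{t_n,t_{n+1}}\simeq q_{n,n+1}\circ i_{n+1}$ for all $n$), and $F$ is the composite of the restriction morphism $(X^m,h_{m,m+1})\to(X^{t_n},h_{t_n,t_{n+1}})$ with $(i_n,\mathrm{id})$. -/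

import Mathlib

open CategoryTheory

universe w v u

noncomputable section

/-! ## Pro-categories: inverse systems and their morphisms -/

/-- An inverse system in `C`: a directed partially ordered set `Idx` and a contravariant functor
from it to `C` (terms and bonding maps). -/
structure InvSystem (C : Type u) [Category.{v} C] where
  Idx : Type w
  [partialOrder : PartialOrder Idx]
  [directed : IsDirectedOrder Idx]
  [nonempty : Nonempty Idx]
  toFunctor : Idxᵒᵖ ⥤ C

namespace InvSystem

attribute [instance] InvSystem.partialOrder InvSystem.directed InvSystem.nonempty

variable {C : Type u} [Category.{v} C]

/-- The term of the system at an index. -/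
abbrev term (X : InvSystem.{w} C) (i : X.Idx) : C := X.toFunctor.obj (Opposite.op i)

/-- The bonding map `X_j ⟶ X_i` for `i ≤ j`. -/
abbrev bond (X : InvSystem.{w} C) {i j : X.Idx} (h : i ≤ j) : X.term j ⟶ X.term i :=
  X.toFunctor.map (homOfLE h).op

lemma bond_comp (X : InvSystem.{w} C) {i j k : X.Idx} (h : i ≤ j) (h' : j ≤ k) :
    X.bond h' ≫ X.bond h = X.bond (h.trans h') := by
  rw [← Functor.map_comp]
  rfl

lemma bond_comp_assoc (X : InvSystem.{w} C) {i j k : X.Idx} (h : i ≤ j) (h' : j ≤ k)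
    {Z : C} (f : X.term i ⟶ Z) :
    X.bond h' ≫ X.bond h ≫ f = X.bond (h.trans h') ≫ f := by
  rw [← Category.assoc, bond_comp]

lemma bond_refl (X : InvSystem.{w} C) (i : X.Idx) : X.bond (le_refl i) = 𝟙 (X.term i) :=
  X.toFunctor.map_id _

/-- A morphism of inverse systems `(f_j, φ) : X → Y`: an index function `φ` and morphisms
`f_j : X_{φ j} ⟶ Y_j`, compatible with the bonding maps after passing to a large index. -/
structure SystemHom (X Y : InvSystem.{w} C) where
  idx : Y.Idx → X.Idx
  app : ∀ j, X.term (idx j) ⟶ Y.term j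
  comm : ∀ ⦃j j' : Y.Idx⦄ (h : j ≤ j'), ∃ (l : X.Idx) (hl : idx j ≤ l) (hl' : idx j' ≤ l),
    X.bond hl ≫ app j = X.bond hl' ≫ app j' ≫ Y.bond h

namespace SystemHom

/-- The identity morphism of systems. -/
def id (X : InvSystem.{w} C) : SystemHom X X where
  idx := fun i => i
  app := fun i => 𝟙 _
  comm := fun i j h => ⟨j, h, le_rfl, by rw [bond_refl]; simp⟩

/-- Composition of morphisms of systems. -/
def comp {X Y Z : InvSystem.{w} C} (f : SystemHom X Y) (g : SystemHom Y Z) :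
    SystemHom X Z where
  idx := fun k => f.idx (g.idx k)
  app := fun k => f.app (g.idx k) ≫ g.app k
  comm := by
    intro k k' h
    obtain ⟨m, hm, hm', e⟩ := g.comm h
    obtain ⟨l₁, a₁, b₁, e₁⟩ := f.comm hm
    obtain ⟨l₂, a₂, b₂, e₂⟩ := f.comm hm'
    obtain ⟨l, h₁, h₂⟩ := exists_ge_ge l₁ l₂
    refine ⟨l, a₁.trans h₁, a₂.trans h₂, ?_⟩
    rw [← bond_comp X a₁ h₁, ← bond_comp X a₂ h₂]
    simp only [Category.assoc]
    rw [reassoc_of% e₁, reassoc_of% e₂, e, bond_comp_assoc, bond_comp_assoc]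

/-- Two morphisms of systems are equivalent if, for each index of the target, their components
agree after passing to a large index of the source. -/
def Equivalent {X Y : InvSystem.{w} C} (f g : SystemHom X Y) : Prop :=
  ∀ j, ∃ (l : X.Idx) (hf : f.idx j ≤ l) (hg : g.idx j ≤ l),
    X.bond hf ≫ f.app j = X.bond hg ≫ g.app j

lemma equivalent_equivalence (X Y : InvSystem.{w} C) :
    Equivalence (Equivalent (X := X) (Y := Y)) where
  refl f j := ⟨f.idx j, le_rfl, le_rfl, rfl⟩
  symm h j := by
    obtain ⟨l, a, b, e⟩ := h j
    exact ⟨l, b, a, e.symm⟩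
  trans h h' j := by
    obtain ⟨l₁, a₁, b₁, e₁⟩ := h j
    obtain ⟨l₂, a₂, b₂, e₂⟩ := h' j
    obtain ⟨l, h₁, h₂⟩ := exists_ge_ge l₁ l₂
    refine ⟨l, a₁.trans h₁, b₂.trans h₂, ?_⟩
    rw [← bond_comp X a₁ h₁, ← bond_comp X b₂ h₂, Category.assoc, Category.assoc, e₁, ← e₂,
      bond_comp_assoc, bond_comp_assoc]

/-- The setoid of morphisms of systems. -/
instance setoid (X Y : InvSystem.{w} C) : Setoid (SystemHom X Y) :=
  ⟨Equivalent, equivalent_equivalence X Y⟩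

lemma comp_equivalent {X Y Z : InvSystem.{w} C} {f f' : SystemHom X Y} {g g' : SystemHom Y Z}
    (hf : Equivalent f f') (hg : Equivalent g g') : Equivalent (f.comp g) (f'.comp g') := by
  intro k
  obtain ⟨m, a, b, e⟩ := hg k
  obtain ⟨l₁, a₁, b₁, e₁⟩ := f.comm a
  obtain ⟨l₂, a₂, b₂, e₂⟩ := f'.comm b
  obtain ⟨l₃, a₃, b₃, e₃⟩ := hf m
  obtain ⟨l₄, h₁, h₂⟩ := exists_ge_ge l₁ l₂
  obtain ⟨l, h₄, h₃⟩ := exists_ge_ge l₄ l₃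
  refine ⟨l, a₁.trans (h₁.trans h₄), a₂.trans (h₂.trans h₄), ?_⟩
  have E₁ := congrArg (fun q => X.bond (h₁.trans h₄) ≫ q ≫ g.app k) e₁
  have E₂ := congrArg (fun q => X.bond (h₂.trans h₄) ≫ q ≫ g'.app k) e₂
  have E₃ := congrArg (fun q => X.bond h₃ ≫ q ≫ Y.bond a ≫ g.app k) e₃
  simp only [Category.assoc, bond_comp_assoc] at E₁ E₂ E₃
  simp only [comp]
  rw [E₁, E₂, E₃, e]

end SystemHom

/-- The category `pro-C`: its objects are the inverse systems in `C`, its morphisms the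
equivalence classes of morphisms of systems. -/
instance proCategory : Category (InvSystem.{w} C) where
  Hom X Y := _root_.Quotient (SystemHom.setoid X Y)
  id X := _root_.Quotient.mk _ (SystemHom.id X)
  comp F G := _root_.Quotient.map₂ SystemHom.comp
    (fun _ _ hf _ _ hg => SystemHom.comp_equivalent hf hg) F G
  id_comp F := by
    refine _root_.Quotient.inductionOn F fun f => ?_
    refine _root_.Quotient.sound fun j => ⟨f.idx j, le_rfl, le_rfl, ?_⟩
    simp [SystemHom.comp, SystemHom.id]
  comp_id F := by
    refine _root_.Quotient.inductionOn F fun f => ?_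
    refine _root_.Quotient.sound fun j => ⟨f.idx j, le_rfl, le_rfl, ?_⟩
    simp [SystemHom.comp, SystemHom.id]
  assoc F G H := by
    refine _root_.Quotient.inductionOn₃ F G H fun f g h => ?_
    refine _root_.Quotient.sound fun j => ⟨f.idx (g.idx (h.idx j)), le_rfl, le_rfl, ?_⟩
    simp [SystemHom.comp]

/-- The morphism of `pro-C` represented by a morphism of systems. -/
def SystemHom.toPro {X Y : InvSystem.{w} C} (f : SystemHom X Y) : X ⟶ Y :=
  _root_.Quotient.mk (SystemHom.setoid X Y) f

/-- `g : X_i ⟶ Y_j` represents the `j`-th component of the morphism `F` of `pro-C`. -/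
def Represents {X Y : InvSystem.{w} C} (F : X ⟶ Y) (i : X.Idx) (j : Y.Idx)
    (g : X.term i ⟶ Y.term j) : Prop :=
  ∃ f : SystemHom X Y, f.toPro = F ∧ ∃ (l : X.Idx) (hf : f.idx j ≤ l) (hi : i ≤ l),
    X.bond hf ≫ f.app j = X.bond hi ≫ g

/-- An inverse sequence, as an inverse system indexed by `ℕ`. -/
def ofSequence (F : ℕᵒᵖ ⥤ C) : InvSystem.{0} C where
  Idx := ℕ
  toFunctor := F

/-- The subsequence `(X_{t n})` of an inverse sequence. -/
def subsequence (F : ℕᵒᵖ ⥤ C) {t : ℕ → ℕ} (ht : StrictMono t) : ℕᵒᵖ ⥤ C :=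
  ht.monotone.functor.op ⋙ F

/-- The restriction morphism from an inverse sequence to a subsequence, given by identities. -/
def restriction (F : ℕᵒᵖ ⥤ C) {t : ℕ → ℕ} (ht : StrictMono t) :
    ofSequence F ⟶ ofSequence (subsequence F ht) :=
  SystemHom.toPro
    { idx := t
      app := fun n => 𝟙 (F.obj (Opposite.op (t n)))
      comm := fun (n m : ℕ) (h : n ≤ m) => ⟨t m, ht.monotone h, le_refl (t m), by
        change F.map (homOfLE (ht.monotone h)).op ≫ 𝟙 (F.obj (Opposite.op (t n))) =
          F.map (𝟙 (Opposite.op (t m))) ≫ 𝟙 (F.obj (Opposite.op (t m))) ≫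
            F.map (homOfLE (ht.monotone h)).op
        simp⟩ }

/-- The level morphism `(f_n, id)`: a natural transformation of inverse sequences, with the
identity as index function. -/
def levelMorphism {F G : ℕᵒᵖ ⥤ C} (f : F ⟶ G) : ofSequence F ⟶ ofSequence G :=
  SystemHom.toPro
    { idx := fun n => n
      app := fun n => f.app (Opposite.op n)
      comm := fun (n m : ℕ) (h : n ≤ m) => ⟨m, h, le_refl m, by
        change F.map (homOfLE h).op ≫ f.app (Opposite.op n) =
          F.map (𝟙 (Opposite.op m)) ≫ f.app (Opposite.op m) ≫ G.map (homOfLE h).op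
        simp⟩ }

end InvSystem

/-! ## The homotopy category and posets as topological spaces -/

/-- The homotopy relation on continuous maps. -/
def homotopyRel : HomRel TopCat.{u} := fun _ _ f g => ContinuousMap.Homotopic f.hom g.hom

/-- The homotopy category of topological spaces. -/
abbrev HTop : Type (u + 1) := CategoryTheory.Quotient homotopyRel.{u}

/-- A partially ordered set as a `T₀` space: the open sets are the lower sets; the continuous
maps induced by order-preserving maps. -/
def posetToTop : PartOrd.{u} ⥤ TopCat.{u} where
  obj P := TopCat.of (Topology.WithLowerSet P)
  map f := TopCat.ofHom (Topology.WithLowerSet.map f.hom)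

/-- The homotopy type of the space of a poset, and the homotopy classes of order-preserving
maps. -/
def posetToHTop : PartOrd.{u} ⥤ HTop.{u} := posetToTop ⋙ CategoryTheory.Quotient.functor _

/-! ## The inverse sequence of barycentric subdivisions -/

namespace Clader

open PartialOrder

lemma exists_least {P : Type u} [PartialOrder P] (c : NonemptyFiniteChains P) :
    ∃ x ∈ c.finset, ∀ y ∈ c.finset, x ≤ y := by
  obtain ⟨x, hx⟩ := c.finset.exists_minimal c.nonempty
  refine ⟨x, hx.prop, fun y hy => ?_⟩
  rcases c.comparable ⟨x, hx.prop⟩ ⟨y, hy⟩ with h | h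
  · exact h
  · exact hx.le_of_le hy h

/-- The first element `x₁` of a chain `x₁ < ⋯ < x_k`. -/
def least {P : Type u} [PartialOrder P] (c : NonemptyFiniteChains P) : P :=
  (exists_least c).choose

lemma least_mem {P : Type u} [PartialOrder P] (c : NonemptyFiniteChains P) :
    least c ∈ c.finset := (exists_least c).choose_spec.1

lemma least_le {P : Type u} [PartialOrder P] (c : NonemptyFiniteChains P) {y : P}
    (hy : y ∈ c.finset) : least c ≤ y := (exists_least c).choose_spec.2 y hy

/-- The finite barycentric subdivision of a poset, with the opposite order: the nonempty finite
chains, ordered by reverse inclusion. -/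
def opSubdivision (P : PartOrd.{u}) : PartOrd.{u} := PartOrd.of (NonemptyFiniteChains P)ᵒᵈ

/-- The map `x₁ < ⋯ < x_k ↦ x₁`. -/
def firstMap (P : PartOrd.{u}) : opSubdivision P ⟶ P :=
  PartOrd.ofHom
    { toFun := fun c : (NonemptyFiniteChains P)ᵒᵈ => least (OrderDual.ofDual c)
      monotone' := fun _ d h => least_le _ (h (least_mem (OrderDual.ofDual d))) }

variable {E : Type u} [AddCommGroup E] [Module ℝ E] (K : Geometry.SimplicialComplex ℝ E)

/-- `X⁰` is the face poset of `K` with the opposite order, and `Xⁿ⁺¹` is the finite barycentric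
subdivision of `Xⁿ` with the opposite order. -/
def poset : ℕ → PartOrd.{u}
  | 0 => PartOrd.of (K.faces)ᵒᵈ
  | n + 1 => opSubdivision (poset n)

/-- The inverse sequence `(Xⁿ, h_{n,n+1})` of posets. -/
def sequence : ℕᵒᵖ ⥤ PartOrd.{u} :=
  Functor.ofOpSequence (X := poset K) (fun n => firstMap (poset K n))

/-- The inverse sequence in the homotopy category. -/
def hSequence : ℕᵒᵖ ⥤ HTop.{u} := sequence K ⋙ posetToHTop

open scoped Classical in
/-- An element of `Xⁿ` is a simplex of the `n`-th barycentric subdivision of `K`; this is its set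
of vertices, as points of `|K|`. The vertices of a chain of simplices are their barycenters. -/
def vertices : (n : ℕ) → poset K n → Finset E
  | 0, s => (OrderDual.ofDual (α := K.faces) s).1
  | n + 1, c => (OrderDual.ofDual (α := NonemptyFiniteChains (poset K n)) c).finset.image
      (fun s => (vertices n s).centroid ℝ _root_.id)

end Clader

/-! ## Finite approximative sequences with the opposite order -/

section FASO

variable {X : Type u} [MetricSpace X]

/-- `A` is an `r`-approximation of `X`. -/
def IsApproximation (r : ℝ) (A : Finset X) : Prop := ∀ x : X, ∃ a ∈ A, dist x a < r

/-- `𝒰_r(A)`: the nonempty subsets of `A` of diameter less than `r`. -/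
@[ext]
structure SmallSubset (A : Finset X) (r : ℝ) where
  carrier : Finset X
  nonempty : carrier.Nonempty
  subset : carrier ⊆ A
  diam_lt : Metric.diam (carrier : Set X) < r

/-- The opposite order: `C ≤ D` if and only if `D ⊆ C`. -/
instance (A : Finset X) (r : ℝ) : PartialOrder (SmallSubset A r) where
  le C D := D.carrier ⊆ C.carrier
  le_refl C := Finset.Subset.refl _
  le_trans _ _ _ h h' := h'.trans h
  le_antisymm _ _ h h' := SmallSubset.ext (h'.antisymm h)

/-- The data of a FASO for `X`: numbers `ε_n > 0` decreasing to `0` and `ε_n`-approximations `A_n`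
such that `ε_{n+1} < (ε_n - γ_n) / 2`, where `γ_n = sup_x d(x, A_n)`. -/
structure FASO (X : Type u) [MetricSpace X] where
  ε : ℕ → ℝ
  A : ℕ → Finset X
  ε_pos : ∀ n, 0 < ε n
  ε_strictAnti : StrictAnti ε
  ε_tendsto : Filter.Tendsto ε Filter.atTop (nhds 0)
  approx : ∀ n, IsApproximation (ε n) (A n)
  gap : ∀ n, ε (n + 1) < (ε n - ⨆ x : X, Metric.infDist x (A n : Set X)) / 2

open scoped Classical in
/-- The points of `A` at distance less than `r` from a point of `C`: `⋃_{x ∈ C} 𝓑(x, r) ∩ A`. -/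
def nearPoints (A : Finset X) (r : ℝ) (C : Set X) : Finset X :=
  {a ∈ A | ∃ x ∈ C, dist x a < r}

lemma mem_nearPoints {A : Finset X} {r : ℝ} {C : Set X} {a : X} :
    a ∈ nearPoints A r C ↔ a ∈ A ∧ ∃ x ∈ C, dist x a < r := by
  simp [nearPoints]

lemma diam_lt_of_finset {C : Finset X} (hC : C.Nonempty) {r : ℝ}
    (h : ∀ x ∈ C, ∀ y ∈ C, dist x y < r) : Metric.diam (C : Set X) < r := by
  obtain ⟨p, hp, hmax⟩ := (C ×ˢ C).exists_max_image (fun p => dist p.1 p.2) (hC.product hC)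
  rw [Finset.mem_product] at hp
  refine lt_of_le_of_lt (Metric.diam_le_of_forall_dist_le dist_nonneg fun x hx y hy => ?_)
    (h p.1 hp.1 p.2 hp.2)
  exact hmax (x, y) (Finset.mem_product.2 ⟨hx, hy⟩)

namespace FASO

variable (S : FASO X)

lemma two_mul_ε_succ_lt (n : ℕ) : 2 * S.ε (n + 1) < S.ε n := by
  have h := S.gap n
  have h0 : 0 ≤ ⨆ x : X, Metric.infDist x (S.A n : Set X) :=
    Real.iSup_nonneg fun x => Metric.infDist_nonneg
  linarith

/-- `𝒰_n = 𝒰_{4ε_n}(A_n)` with the opposite order. -/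
def poset (n : ℕ) : PartOrd.{u} := PartOrd.of (SmallSubset (S.A n) (4 * S.ε n))

/-- The bonding map `q_{n,n+1}(C) = ⋃_{x ∈ C} 𝓑(x, ε_n) ∩ A_n`. -/
def bonding (n : ℕ) : S.poset (n + 1) ⟶ S.poset n :=
  PartOrd.ofHom
    { toFun := fun C : SmallSubset (S.A (n + 1)) (4 * S.ε (n + 1)) =>
        have hne : (nearPoints (S.A n) (S.ε n) (C.carrier : Set X)).Nonempty := by
          obtain ⟨x, hx⟩ := C.nonempty
          obtain ⟨a, ha, hd⟩ := S.approx n x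
          exact ⟨a, mem_nearPoints.2 ⟨ha, x, hx, hd⟩⟩
        { carrier := nearPoints (S.A n) (S.ε n) (C.carrier : Set X)
          nonempty := hne
          subset := fun a ha => (mem_nearPoints.1 ha).1
          diam_lt := by
            refine diam_lt_of_finset hne fun a ha b hb => ?_
            obtain ⟨-, x, hx, hxa⟩ := mem_nearPoints.1 ha
            obtain ⟨-, y, hy, hyb⟩ := mem_nearPoints.1 hb
            have hxy : dist x y < 4 * S.ε (n + 1) :=
              (Metric.dist_le_diam_of_mem C.carrier.finite_toSet.isBounded hx hy).trans_lt C.diam_lt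
            have h4 := dist_triangle4 a x y b
            have := S.two_mul_ε_succ_lt n
            rw [dist_comm a x] at h4
            linarith }
      monotone' := fun C D h a ha => by
        obtain ⟨haA, x, hx, hd⟩ := mem_nearPoints.1 ha
        exact mem_nearPoints.2 ⟨haA, x, h hx, hd⟩ }

/-- The inverse sequence `(𝒰_n, q_{n,n+1})` of posets. -/
def sequence : ℕᵒᵖ ⥤ PartOrd.{u} :=
  Functor.ofOpSequence (X := S.poset) S.bonding

/-- The inverse sequence in the homotopy category. -/
def hSequence : ℕᵒᵖ ⥤ HTop.{u} := S.sequence ⋙ posetToHTop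

variable {E : Type u} [AddCommGroup E] [Module ℝ E]

/-- Let `e` identify `X` with `|K|`. The order-preserving map `i : X^m → 𝒰_n` is the natural one
if it sends a simplex of the `m`-th subdivision with vertices `v₀, …, v_k` to
`⋃_j 𝓑(v_j, ε_n) ∩ A_n`. -/
def IsNaturalMap (K : Geometry.SimplicialComplex ℝ E) (e : X → E) {m n : ℕ}
    (i : Clader.poset K m →o SmallSubset (S.A n) (4 * S.ε n)) : Prop :=
  ∀ s : Clader.poset K m,
    (i s).carrier = nearPoints (S.A n) (S.ε n) (e ⁻¹' (Clader.vertices K m s : Set E))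

/-- The homotopy class of an order-preserving map `X^m → 𝒰_n`. -/
def hClass (K : Geometry.SimplicialComplex ℝ E) {m n : ℕ}
    (i : Clader.poset K m →o SmallSubset (S.A n) (4 * S.ε n)) :
    (Clader.hSequence K).obj (Opposite.op m) ⟶ S.hSequence.obj (Opposite.op n) :=
  posetToHTop.map (X := Clader.poset K m) (Y := S.poset n) (PartOrd.ofHom i)

/-- A morphism of `pro-HTop` from the subdivision sequence to the FASO is natural if, for every
`n` and all large `m`, its `n`-th component is represented by the natural map `X^m → 𝒰_n`. -/
def IsNaturalMorphism (K : Geometry.SimplicialComplex ℝ E) (e : X → E)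
    (F : InvSystem.ofSequence (Clader.hSequence K) ⟶ InvSystem.ofSequence S.hSequence) :
    Prop :=
  ∀ n : ℕ, ∃ m₀ : ℕ, ∀ m ≥ m₀,
    ∃ i : Clader.poset K m →o SmallSubset (S.A n) (4 * S.ε n),
      S.IsNaturalMap K e i ∧
        InvSystem.Represents (X := InvSystem.ofSequence (Clader.hSequence K))
          (Y := InvSystem.ofSequence S.hSequence) F m n (S.hClass K i)

end FASO

end FASO

end

/-!
The natural maps `X^m → 𝒰_n` are compared by contiguity. If `f ≤ g` are order-preserving maps, the
maps of spaces that they induce are homotopic (`posetToHTop_map_eq_of_le`). Let two antitone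
families of sets `W` and `W'` induce maps to `𝒰_n` by `p ↦ ⋃_{x ∈ W p} 𝓑(x, ε_n) ∩ A_n`, and let
the points of `W p ∪ W' p` be closer to each other than `2 ε_n`. Then the unions induce a map to
`𝒰_n` that lies below both, so that the two maps are homotopic (`posetToHTop_map_eq_of_union`).

This applies once the mesh of the `m`-th subdivision, measured in the metric of `X`, is less than
`ε_n`. Then the natural map `X^m → 𝒰_n` exists, and, up to homotopy, the natural maps are compatible
with the bonding maps of the source (`FASO.IsNaturalMap.map_comp_hClass`), because the vertices of a
simplex of the next subdivision lie in the simplex to which it is sent, and with those of the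
target (`FASO.IsNaturalMap.hClass_comp_map`), because the map to `𝒰_{n+1}` only replaces
vertices by points at distance less than `ε_{n+1} < ε_n / 2`.

The mesh tends to zero by the classical estimate: subdividing a simplex with at most `N` vertices
shrinks it by the factor `1 - 1 / N` (`Clader.exists_dist_vertices_le`), the number of vertices is
bounded uniformly in `m` because so is the length of chains (`Clader.exists_bound_card`), and the
inverse of the embedding of the compact space `X` is uniformly continuous
(`Clader.exists_meshLT`).

For `t n` large the natural maps therefore form a level morphism out of the subsequence `X^{t n}`,
and its composite with the restriction is natural. There is only one natural morphism, since a
natural map is determined by its formula and a morphism of the pro-category by morphisms that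
represent its components (`InvSystem.eq_of_represents`).
-/

/-! ### Comparable order-preserving maps are homotopic -/

/-- The homotopy stays at `f` for `t < 1` and jumps to `g` at `t = 1`; it is continuous because a
lower set that contains `g p` contains `f p`. -/
lemma posetToHTop_map_eq_of_le {P Q : PartOrd.{u}} (f g : P ⟶ Q) (h : ∀ p, f p ≤ g p) :
    posetToHTop.map f = posetToHTop.map g := by
  classical
  refine CategoryTheory.Quotient.sound _ ?_
  refine ⟨⟨⟨fun z => if z.1 < 1 then (posetToTop.map f).hom z.2 else (posetToTop.map g).hom z.2,
    ?_⟩, fun x => by simp, fun x => by simp⟩⟩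
  refine ⟨fun U hU => ?_⟩
  have hU₀ : IsOpen (X := Topology.WithLowerSet Q) U := hU
  have hU' := Topology.IsLowerSet.isOpen_iff_isLowerSet.1 hU₀
  have key : (fun z : unitInterval × posetToTop.obj P =>
      if z.1 < 1 then (posetToTop.map f).hom z.2 else (posetToTop.map g).hom z.2) ⁻¹' U =
      ({t | t < 1} ×ˢ ((posetToTop.map f).hom ⁻¹' U)) ∪
        (Set.univ ×ˢ ((posetToTop.map g).hom ⁻¹' U)) := by
    ext ⟨t, p⟩
    have hp : (posetToTop.map g).hom p ∈ U → (posetToTop.map f).hom p ∈ U := fun hg => hU' (h p) hg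
    by_cases ht : t < 1 <;> simp [ht]
    exact hp
  rw [key]
  exact ((isOpen_Iio (a := (1 : unitInterval))).prod
    (hU.preimage (posetToTop.map f).hom.continuous)).union
    (isOpen_univ.prod (hU.preimage (posetToTop.map g).hom.continuous))

section NearPoints

variable {X : Type u} [MetricSpace X]

lemma nearPoints_mono {A : Finset X} {r : ℝ} {C D : Set X} (h : C ⊆ D) :
    nearPoints A r C ⊆ nearPoints A r D := fun a ha => by
  obtain ⟨haA, x, hx, hd⟩ := mem_nearPoints.1 ha
  exact mem_nearPoints.2 ⟨haA, x, h hx, hd⟩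

/-- An antitone family of nonempty sets whose points are pairwise closer than `2 * r` induces an
order-preserving map to `𝒰_{4r}(A)`. -/
noncomputable def nearPointsHom {P : Type*} [PartialOrder P] (A : Finset X) (r : ℝ) (W : P → Set X)
    (hW : Antitone W) (hne : ∀ p, (nearPoints A r (W p)).Nonempty)
    (hd : ∀ p, ∀ x ∈ W p, ∀ y ∈ W p, dist x y < 2 * r) : P →o SmallSubset A (4 * r) where
  toFun p :=
    { carrier := nearPoints A r (W p)
      nonempty := hne p
      subset := fun a ha => (mem_nearPoints.1 ha).1
      diam_lt := by
        refine diam_lt_of_finset (hne p) fun a ha b hb => ?_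
        obtain ⟨-, x, hx, hxa⟩ := mem_nearPoints.1 ha
        obtain ⟨-, y, hy, hyb⟩ := mem_nearPoints.1 hb
        have h4 := dist_triangle4 a x y b
        have := hd p x hx y hy
        rw [dist_comm a x] at h4
        linarith }
  monotone' _ _ h := nearPoints_mono (hW h)

/-- Contiguous families induce homotopic maps: if the unions `W p ∪ W' p` are still small, then the
map that they induce lies below both of the maps induced by `W` and `W'`. -/
lemma posetToHTop_map_eq_of_union {P : PartOrd.{u}} {A : Finset X} {r : ℝ}
    (f g : P ⟶ PartOrd.of (SmallSubset A (4 * r))) (W W' : P → Set X)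
    (hW : Antitone W) (hW' : Antitone W')
    (hf : ∀ p, (f p).carrier = nearPoints A r (W p))
    (hg : ∀ p, (g p).carrier = nearPoints A r (W' p))
    (hd : ∀ p, ∀ x ∈ W p ∪ W' p, ∀ y ∈ W p ∪ W' p, dist x y < 2 * r) :
    posetToHTop.map f = posetToHTop.map g := by
  let k : P ⟶ PartOrd.of (SmallSubset A (4 * r)) := PartOrd.ofHom
    (nearPointsHom A r (fun p => W p ∪ W' p)
      (fun p q h => Set.union_subset_union (hW h) (hW' h))
      (fun p => ((f p).nonempty.mono
        ((hf p).subset.trans (nearPoints_mono Set.subset_union_left)))) hd)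
  have h₁ : posetToHTop.map k = posetToHTop.map f := posetToHTop_map_eq_of_le k f fun p =>
    (hf p).subset.trans (nearPoints_mono Set.subset_union_left)
  have h₂ : posetToHTop.map k = posetToHTop.map g := posetToHTop_map_eq_of_le k g fun p =>
    (hg p).subset.trans (nearPoints_mono Set.subset_union_right)
  exact h₁.symm.trans h₂

end NearPoints

/-! ### The mesh of the iterated barycentric subdivisions -/

namespace Clader

open PartialOrder

/-- A chain of nonempty sets with at most `N` elements has at most `N` members, since they are told
apart by their cardinalities. -/
lemma card_le_of_chain {Q α : Type*} (c : Finset Q) (f : Q → Finset α) {N : ℕ}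
    (hinj : Function.Injective f) (hc : ∀ a ∈ c, ∀ b ∈ c, f a ⊆ f b ∨ f b ⊆ f a)
    (hN : ∀ a ∈ c, (f a).Nonempty ∧ (f a).card ≤ N) : c.card ≤ N := by
  have hmaps : Set.MapsTo (fun a => (f a).card) c (Finset.Icc 1 N) := fun a ha => by
    simpa [Nat.one_le_iff_ne_zero, Finset.card_eq_zero, Finset.nonempty_iff_ne_empty] using hN a ha
  have hi : Set.InjOn (fun a => (f a).card) c := fun a ha b hb (hab : (f a).card = (f b).card) => by
    rcases hc a ha b hb with h | h
    · exact hinj (Finset.eq_of_subset_of_card_le h hab.ge)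
    · exact hinj (Finset.eq_of_subset_of_card_le h hab.le).symm
  simpa using Finset.card_le_card_of_injOn _ hmaps hi

/-- The constant comes from averaging the differences `w - v` over the vertices `w`: at least one
of at most `N` summands vanishes. -/
lemma dist_centroid_le {E : Type*} [NormedAddCommGroup E] [NormedSpace ℝ E] {V : Finset E}
    {N : ℕ} {D : ℝ} (hV : V.Nonempty) (hN : V.card ≤ N) (hD : ∀ v ∈ V, ∀ w ∈ V, dist v w ≤ D)
    {p : E} (hp : p ∈ convexHull ℝ (V : Set E)) :
    dist p (V.centroid ℝ _root_.id) ≤ (1 - (N : ℝ)⁻¹) * D := by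
  classical
  have hD0 : 0 ≤ D := by
    obtain ⟨v, hv⟩ := hV
    exact dist_nonneg.trans (hD v hv v hv)
  have hk : (0 : ℝ) < V.card := by exact_mod_cast hV.card_pos
  refine (convexHull_min (fun v hv => ?_) (convex_closedBall (V.centroid ℝ _root_.id) _) hp :
    p ∈ Metric.closedBall _ _)
  rw [Finset.mem_coe] at hv
  have hc : V.centroid ℝ _root_.id - v = ∑ w ∈ V, (V.card : ℝ)⁻¹ • (w - v) := by
    rw [Finset.centroid_eq_centerMass V hV, Finset.centerMass_eq_of_sum_1 _ _
      (Finset.sum_centroidWeights_eq_one_of_nonempty ℝ V hV)]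
    simp only [Finset.centroidWeights_apply, smul_sub, Finset.sum_sub_distrib, id]
    congr 1
    rw [Finset.sum_const, ← Nat.cast_smul_eq_nsmul ℝ, smul_smul, mul_inv_cancel₀ hk.ne', one_smul]
  rw [Metric.mem_closedBall, dist_comm, dist_eq_norm, hc, ← Finset.add_sum_erase _ _ hv]
  -- The summand of `v` itself vanishes, which leaves `card V - 1` summands.
  calc _ ≤ ∑ w ∈ V.erase v, (V.card : ℝ)⁻¹ * D := by
        rw [sub_self, smul_zero, zero_add]
        refine norm_sum_le_of_le _ fun w hw => ?_
        rw [norm_smul, Real.norm_of_nonneg (inv_nonneg.2 hk.le), ← dist_eq_norm]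
        exact mul_le_mul_of_nonneg_left (hD w (Finset.mem_of_mem_erase hw) v hv)
          (inv_nonneg.2 hk.le)
    _ = (1 - (V.card : ℝ)⁻¹) * D := by
        rw [Finset.sum_const, Finset.card_erase_of_mem hv, nsmul_eq_mul,
          Nat.cast_pred hV.card_pos]
        field_simp
    _ ≤ _ := by gcongr

variable {E : Type u}

section Module

variable [AddCommGroup E] [Module ℝ E] (K : Geometry.SimplicialComplex ℝ E)

lemma mem_vertices_succ {m : ℕ} {c : poset K (m + 1)} {v : E} :
    v ∈ vertices K (m + 1) c ↔
      ∃ s ∈ (OrderDual.ofDual (α := NonemptyFiniteChains (poset K m)) c).finset,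
        (vertices K m s).centroid ℝ _root_.id = v := by
  classical
  simp [vertices]

lemma vertices_nonempty : ∀ (m : ℕ) (s : poset K m), (vertices K m s).Nonempty
  | 0, s => K.nonempty_of_mem_faces (OrderDual.ofDual (α := K.faces) s).2
  | m + 1, c => by
    classical
    exact (OrderDual.ofDual (α := NonemptyFiniteChains (poset K m)) c).nonempty.image _

lemma vertices_antitone : ∀ m : ℕ, Antitone (vertices K m)
  | 0 => fun _ _ h => h
  | m + 1 => fun c d h v hv => by
    obtain ⟨s, hs, rfl⟩ := (mem_vertices_succ K).1 hv
    exact (mem_vertices_succ K).2 ⟨s, h hs, rfl⟩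

lemma antitone_preimage_vertices {X : Type*} (e : X → E) (m : ℕ) :
    Antitone fun s : poset K m => e ⁻¹' (vertices K m s : Set E) :=
  fun _ _ h => Set.preimage_mono (Finset.coe_subset.2 (vertices_antitone K m h))

lemma centroid_mem_convexHull_vertices {m : ℕ} (s : poset K m) :
    (vertices K m s).centroid ℝ _root_.id ∈ convexHull ℝ (vertices K m s : Set E) :=
  Finset.centroid_mem_convexHull _ (vertices_nonempty K m s)

/-- Every simplex of a subdivision lies in the simplex to which the bonding map sends it. -/
lemma vertices_subset_convexHull_firstMap {m : ℕ} (c : poset K (m + 1)) :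
    (vertices K (m + 1) c : Set E) ⊆
      convexHull ℝ (vertices K m (firstMap (poset K m) c) : Set E) := fun v hv => by
  obtain ⟨s, hs, rfl⟩ := (mem_vertices_succ K).1 hv
  exact convexHull_mono (Finset.coe_subset.2 (vertices_antitone K m (least_le _ hs)))
    (centroid_mem_convexHull_vertices K s)

lemma convexHull_vertices_subset_space :
    ∀ (m : ℕ) (s : poset K m), convexHull ℝ (vertices K m s : Set E) ⊆ K.space
  | 0, s => K.convexHull_subset_space (OrderDual.ofDual (α := K.faces) s).2
  | m + 1, c => (convexHull_min (vertices_subset_convexHull_firstMap K c)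
      (convex_convexHull ℝ _)).trans (convexHull_vertices_subset_space m _)

/-- The iterated subdivisions of a finite complex have bounded dimension. It is the length of the
chains that bounds it: a strictly increasing chain of chains of at most `N` elements has itself at
most `N` elements. -/
lemma exists_bound_card (hK : K.faces.Finite) : ∃ N : ℕ, 0 < N ∧ ∀ m : ℕ,
    (∀ c : Finset (poset K m), (∀ a ∈ c, ∀ b ∈ c, a ≤ b ∨ b ≤ a) → c.card ≤ N) ∧
      ∀ s : poset K m, (vertices K m s).card ≤ N := by
  classical
  obtain ⟨N, hN⟩ := (hK.image Finset.card).bddAbove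
  refine ⟨N + 1, N.succ_pos, fun m => ?_⟩
  induction m with
  | zero =>
    have hV (s : poset K 0) : (vertices K 0 s).card ≤ N + 1 :=
      (hN ⟨_, (OrderDual.ofDual (α := K.faces) s).2, rfl⟩).trans N.le_succ
    refine ⟨fun c hc => card_le_of_chain c (vertices K 0) ?_
      (fun a ha b hb => (hc a ha b hb).symm) fun a _ => ⟨vertices_nonempty K 0 a, hV a⟩, hV⟩
    exact fun a b h => Subtype.ext (p := (· ∈ K.faces)) h
  | succ m ih =>
    have hC (c : poset K (m + 1)) :
        (OrderDual.ofDual (α := NonemptyFiniteChains (poset K m)) c).finset.card ≤ N + 1 :=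
      ih.1 _ fun a ha b hb => NonemptyFiniteChains.comparable _ ⟨a, ha⟩ ⟨b, hb⟩
    refine ⟨fun c hc => card_le_of_chain c
      (fun d : poset K (m + 1) =>
        (OrderDual.ofDual (α := NonemptyFiniteChains (poset K m)) d).finset) ?_
      (fun a ha b hb => (hc a ha b hb).symm) fun a _ =>
        ⟨(OrderDual.ofDual (α := NonemptyFiniteChains (poset K m)) a).nonempty, hC a⟩,
      fun c => Finset.card_image_le.trans (hC c)⟩
    exact fun a b h => NonemptyFiniteChains.ext h

end Module

variable [NormedAddCommGroup E] [NormedSpace ℝ E] (K : Geometry.SimplicialComplex ℝ E)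

/-- The mesh of the `m`-th subdivision decays geometrically: one subdivision multiplies it by at
most `1 - 1 / N`, where `N` bounds the number of vertices of a simplex. -/
lemma exists_dist_vertices_le (hK : K.faces.Finite) : ∃ D r : ℝ, 0 ≤ r ∧ r < 1 ∧
    ∀ (m : ℕ) (s : poset K m), ∀ v ∈ vertices K m s, ∀ w ∈ vertices K m s,
      dist v w ≤ r ^ m * D := by
  obtain ⟨N, hN0, hN⟩ := exists_bound_card K hK
  have hN1 : (1 : ℝ) ≤ N := by exact_mod_cast hN0
  obtain ⟨D, hD⟩ := (hK.image fun s : Finset E => Metric.diam (s : Set E)).bddAbove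
  refine ⟨D, 1 - (N : ℝ)⁻¹, sub_nonneg.2 (inv_le_one_of_one_le₀ hN1),
    sub_lt_self _ (by positivity), fun m => ?_⟩
  induction m with
  | zero =>
    intro s v hv w hw
    rw [pow_zero, one_mul]
    exact (Metric.dist_le_diam_of_mem (vertices K 0 s).finite_toSet.isBounded hv hw).trans
      (hD ⟨_, (OrderDual.ofDual (α := K.faces) s).2, rfl⟩)
  | succ m ih =>
    have key (s t : poset K m) (h : s ≤ t) : dist ((vertices K m t).centroid ℝ _root_.id)
        ((vertices K m s).centroid ℝ _root_.id) ≤ (1 - (N : ℝ)⁻¹) ^ (m + 1) * D := by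
      rw [pow_succ', mul_assoc]
      exact dist_centroid_le (vertices_nonempty K m s) ((hN m).2 s) (ih s)
        (convexHull_mono (Finset.coe_subset.2 (vertices_antitone K m h))
          (centroid_mem_convexHull_vertices K t))
    intro c v hv w hw
    obtain ⟨s, hs, rfl⟩ := (mem_vertices_succ K).1 hv
    obtain ⟨t, ht, rfl⟩ := (mem_vertices_succ K).1 hw
    rcases NonemptyFiniteChains.comparable _ ⟨s, hs⟩ ⟨t, ht⟩ with h | h
    · rw [dist_comm]
      exact key s t h
    · exact key t s h

variable {X : Type*} [MetricSpace X]

/-- The simplices of the `m`-th subdivision of `K` have diameter less than `δ`, as subsets of a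
metric space `X` that `e` identifies with `|K|`. -/
def MeshLT (e : X → E) (m : ℕ) (δ : ℝ) : Prop :=
  ∀ (s : poset K m) (x y : X), e x ∈ convexHull ℝ (vertices K m s : Set E) →
    e y ∈ convexHull ℝ (vertices K m s : Set E) → dist x y < δ

lemma exists_meshLT (hK : K.faces.Finite) [CompactSpace X] {e : X → E}
    (he : Topology.IsEmbedding e) {δ : ℝ} (hδ : 0 < δ) :
    ∃ m₀ : ℕ, ∀ m ≥ m₀, MeshLT K e m δ := by
  have : CompactSpace (Set.range e) :=
    isCompact_iff_compactSpace.1 (isCompact_range he.continuous)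
  obtain ⟨η, hη, hηδ⟩ := Metric.uniformContinuous_iff.1
    (CompactSpace.uniformContinuous_of_continuous he.toHomeomorph.symm.continuous) δ hδ
  replace hηδ {x y : X} (h : dist (e x) (e y) < η) : dist x y < δ := by
    simpa using hηδ (a := he.toHomeomorph x) (b := he.toHomeomorph y) h
  obtain ⟨D, r, hr0, hr1, hD⟩ := exists_dist_vertices_le K hK
  have ht : Filter.Tendsto (fun m : ℕ => r ^ m * D) Filter.atTop (nhds 0) := by
    simpa using (tendsto_pow_atTop_nhds_zero_of_lt_one hr0 hr1).mul_const D
  obtain ⟨m₀, hm₀⟩ := Filter.eventually_atTop.1 (ht.eventually_lt_const hη)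
  refine ⟨m₀, fun m hm s x y hx hy => hηδ (lt_of_le_of_lt ?_ (hm₀ m hm))⟩
  obtain ⟨v, hv, w, hw, h⟩ := convexHull_exists_dist_ge2 hx hy
  exact h.trans (hD m s v hv w hw)

end Clader

/-! ### Morphisms of pro-categories out of inverse sequences -/

namespace InvSystem

variable {C : Type u} [Category.{v} C]

/-- A morphism is determined by morphisms that represent its components. -/
lemma eq_of_represents {X Y : InvSystem.{w} C} {F G : X ⟶ Y}
    (h : ∀ j, ∃ (i : X.Idx) (g : X.term i ⟶ Y.term j), Represents F i j g ∧ Represents G i j g) :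
    F = G := by
  obtain ⟨f, rfl⟩ := _root_.Quotient.exists_rep F
  obtain ⟨g, rfl⟩ := _root_.Quotient.exists_rep G
  -- A representative of `F` may be exchanged for `f`, and one of `G` for `g`, at a larger index.
  have key (f : SystemHom X Y) {i : X.Idx} {j : Y.Idx} {a : X.term i ⟶ Y.term j}
      (ha : Represents f.toPro i j a) : ∃ (l : X.Idx) (hf : f.idx j ≤ l) (hi : i ≤ l),
        X.bond hf ≫ f.app j = X.bond hi ≫ a := by
    obtain ⟨f', hf', l, h₁, h₂, e⟩ := ha
    obtain ⟨l', h₃, h₄, e'⟩ := _root_.Quotient.exact hf' j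
    obtain ⟨k, hl, hl'⟩ := exists_ge_ge l l'
    refine ⟨k, h₄.trans hl', h₂.trans hl, ?_⟩
    rw [← bond_comp X h₄ hl', ← bond_comp X h₂ hl, Category.assoc, Category.assoc, ← e, ← e',
      bond_comp_assoc, bond_comp_assoc]
  refine _root_.Quotient.sound fun j => ?_
  obtain ⟨i, a, hf, hg⟩ := h j
  obtain ⟨l, h₁, h₂, e⟩ := key f hf
  obtain ⟨l', h₃, h₄, e'⟩ := key g hg
  obtain ⟨k, hl, hl'⟩ := exists_ge_ge l l'
  refine ⟨k, h₁.trans hl, h₃.trans hl', ?_⟩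
  rw [← bond_comp X h₁ hl, ← bond_comp X h₃ hl', Category.assoc, Category.assoc, e, e',
    bond_comp_assoc, bond_comp_assoc]

lemma represents_restriction_comp_levelMorphism {F G : ℕᵒᵖ ⥤ C} {t : ℕ → ℕ} (ht : StrictMono t)
    (J : subsequence F ht ⟶ G) {m n l : ℕ} (hl : t n ≤ l) (hm : m ≤ l)
    (g : F.obj (Opposite.op m) ⟶ G.obj (Opposite.op n))
    (h : F.map (homOfLE hl).op ≫ J.app (Opposite.op n) = F.map (homOfLE hm).op ≫ g) :
    Represents (X := ofSequence F) (Y := ofSequence G)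
      (restriction F ht ≫ levelMorphism J) m n g := by
  refine ⟨_, rfl, l, hl, hm, ?_⟩
  refine Eq.trans ?_ h
  exact congrArg (F.map (homOfLE hl).op ≫ ·) (Category.id_comp (J.app (Opposite.op n)))

end InvSystem

/-! ### The natural maps and their compatibility up to homotopy -/

namespace FASO

variable {E X : Type u} [NormedAddCommGroup E] [NormedSpace ℝ E]
  {K : Geometry.SimplicialComplex ℝ E} [MetricSpace X] {e : X → E} (S : FASO X)

variable {S} in
lemma IsNaturalMap.unique {m n : ℕ} {i i' : Clader.poset K m →o SmallSubset (S.A n) (4 * S.ε n)}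
    (hi : S.IsNaturalMap K e i) (hi' : S.IsNaturalMap K e i') : i = i' :=
  OrderHom.ext _ _ (funext fun s => SmallSubset.ext ((hi s).trans (hi' s).symm))

lemma exists_isNaturalMap (he_range : Set.range e = K.space) {m n : ℕ}
    (hm : Clader.MeshLT K e m (S.ε n)) :
    ∃ i : Clader.poset K m →o SmallSubset (S.A n) (4 * S.ε n), S.IsNaturalMap K e i := by
  refine ⟨nearPointsHom (S.A n) (S.ε n) _ (Clader.antitone_preimage_vertices K e m) (fun s => ?_)
    fun s x hx y hy => ?_, fun s => rfl⟩
  · obtain ⟨v, hv⟩ := Clader.vertices_nonempty K m s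
    obtain ⟨x, rfl⟩ : v ∈ Set.range e := he_range ▸
      Clader.convexHull_vertices_subset_space K m s (subset_convexHull ℝ _ hv)
    obtain ⟨a, ha, hd⟩ := S.approx n x
    exact ⟨a, mem_nearPoints.2 ⟨ha, x, hv, hd⟩⟩
  · have := hm s x y (subset_convexHull ℝ _ hx) (subset_convexHull ℝ _ hy)
    linarith [S.ε_pos n]

variable {S} in
/-- A simplex of the subdivision and the simplex that contains it span a set of small diameter, so
that their images in `𝒰_n` are contiguous. -/
lemma IsNaturalMap.map_succ_comp_hClass {m n : ℕ} (hm : Clader.MeshLT K e m (S.ε n))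
    {i : Clader.poset K m →o SmallSubset (S.A n) (4 * S.ε n)}
    {i' : Clader.poset K (m + 1) →o SmallSubset (S.A n) (4 * S.ε n)}
    (hi : S.IsNaturalMap K e i) (hi' : S.IsNaturalMap K e i') :
    (Clader.hSequence K).map (homOfLE (Nat.le_add_right m 1)).op ≫ S.hClass K i =
      S.hClass K i' := by
  have hb : (Clader.hSequence K).map (homOfLE (Nat.le_add_right m 1)).op =
      posetToHTop.map (Clader.firstMap (Clader.poset K m)) :=
    congrArg posetToHTop.map (Functor.ofOpSequence_map_homOfLE_succ _ m)
  rw [hb]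
  refine (posetToHTop.map_comp (Clader.firstMap (Clader.poset K m))
    (PartOrd.ofHom i : Clader.poset K m ⟶ S.poset n)).symm.trans ?_
  refine posetToHTop_map_eq_of_union _ _
    (fun c : Clader.poset K (m + 1) =>
      e ⁻¹' (Clader.vertices K m (Clader.firstMap (Clader.poset K m) c) : Set E))
    (fun c : Clader.poset K (m + 1) => e ⁻¹' (Clader.vertices K (m + 1) c : Set E))
    (fun c d h => Clader.antitone_preimage_vertices K e m
      ((Clader.firstMap (Clader.poset K m)).hom.monotone h))
    (Clader.antitone_preimage_vertices K e (m + 1))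
    (fun c => hi _) (fun c => hi' c) fun c x hx y hy => ?_
  have hull : ∀ z ∈ e ⁻¹' (Clader.vertices K m (Clader.firstMap (Clader.poset K m) c) : Set E) ∪
      e ⁻¹' (Clader.vertices K (m + 1) c : Set E),
      e z ∈ convexHull ℝ
        (Clader.vertices K m (Clader.firstMap (Clader.poset K m) c) : Set E) := by
    rintro z (hz | hz)
    · exact subset_convexHull ℝ _ hz
    · exact Clader.vertices_subset_convexHull_firstMap K c hz
  have := hm _ x y (hull x hx) (hull y hy)
  linarith [S.ε_pos n]

variable {S} in
lemma IsNaturalMap.map_comp_hClass (he_range : Set.range e = K.space) {m m' n : ℕ} (h : m ≤ m')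
    (hm : ∀ k ≥ m, Clader.MeshLT K e k (S.ε n))
    {i : Clader.poset K m →o SmallSubset (S.A n) (4 * S.ε n)}
    {i' : Clader.poset K m' →o SmallSubset (S.A n) (4 * S.ε n)}
    (hi : S.IsNaturalMap K e i) (hi' : S.IsNaturalMap K e i') :
    (Clader.hSequence K).map (homOfLE h).op ≫ S.hClass K i = S.hClass K i' := by
  induction m', h using Nat.le_induction with
  | base =>
    obtain rfl := hi.unique hi'
    exact (congrArg (· ≫ S.hClass K i) ((Clader.hSequence K).map_id (Opposite.op m))).trans
      (Category.id_comp _)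
  | succ k hk ih =>
    obtain ⟨j, hj⟩ := S.exists_isNaturalMap he_range (hm k hk)
    have hc : (Clader.hSequence K).map (homOfLE (hk.trans (Nat.le_add_right k 1))).op =
        (Clader.hSequence K).map (homOfLE (Nat.le_add_right k 1)).op ≫
          (Clader.hSequence K).map (homOfLE hk).op := by
      rw [← Functor.map_comp]
      rfl
    rw [← hj.map_succ_comp_hClass (hm k hk) hi', ← ih hj, ← Category.assoc, ← hc]

variable {S} in
/-- The two images of a simplex in `𝒰_n` are contiguous: `i'` replaces its vertices by points of
`A_{n+1}` at distance less than `ε_{n+1}`, and `2 ε_{n+1} < ε_n`. -/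
lemma IsNaturalMap.hClass_comp_map {m n : ℕ} (hm : Clader.MeshLT K e m (S.ε n))
    {i : Clader.poset K m →o SmallSubset (S.A n) (4 * S.ε n)}
    {i' : Clader.poset K m →o SmallSubset (S.A (n + 1)) (4 * S.ε (n + 1))}
    (hi : S.IsNaturalMap K e i) (hi' : S.IsNaturalMap K e i') :
    S.hClass K i' ≫ S.hSequence.map (homOfLE (Nat.le_add_right n 1)).op = S.hClass K i := by
  have hb : S.hSequence.map (homOfLE (Nat.le_add_right n 1)).op =
      posetToHTop.map (S.bonding n) :=
    congrArg posetToHTop.map (Functor.ofOpSequence_map_homOfLE_succ _ n)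
  rw [hb]
  refine (posetToHTop.map_comp (PartOrd.ofHom i' : Clader.poset K m ⟶ S.poset (n + 1))
    (S.bonding n)).symm.trans ?_
  refine posetToHTop_map_eq_of_union _ _ (fun s : Clader.poset K m => ((i' s).carrier : Set X))
    (fun s : Clader.poset K m => e ⁻¹' (Clader.vertices K m s : Set E))
    (fun s t h => Finset.coe_subset.2 (i'.monotone h)) (Clader.antitone_preimage_vertices K e m)
    (fun s => rfl) (fun s => hi s) fun s x hx y hy => ?_
  have near : ∀ z ∈ ((i' s).carrier : Set X) ∪ e ⁻¹' (Clader.vertices K m s : Set E),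
      ∃ w, e w ∈ convexHull ℝ (Clader.vertices K m s : Set E) ∧ dist w z < S.ε (n + 1) := by
    rintro z (hz | hz)
    · rw [Finset.mem_coe, hi' s] at hz
      obtain ⟨-, w, hw, hd⟩ := mem_nearPoints.1 hz
      exact ⟨w, subset_convexHull ℝ _ hw, hd⟩
    · exact ⟨z, subset_convexHull ℝ _ hz, by simpa using S.ε_pos (n + 1)⟩
  obtain ⟨x', hx', hxd⟩ := near x hx
  obtain ⟨y', hy', hyd⟩ := near y hy
  have := hm s x' y' hx' hy'
  have := S.two_mul_ε_succ_lt n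
  have h4 := dist_triangle4 x x' y' y
  rw [dist_comm x x'] at h4
  linarith

variable {S} in
lemma IsNaturalMorphism.unique
    {F G : InvSystem.ofSequence (Clader.hSequence K) ⟶ InvSystem.ofSequence S.hSequence}
    (hF : S.IsNaturalMorphism K e F) (hG : S.IsNaturalMorphism K e G) : F = G := by
  refine InvSystem.eq_of_represents fun (n : ℕ) => ?_
  obtain ⟨m₁, h₁⟩ := hF n
  obtain ⟨m₂, h₂⟩ := hG n
  obtain ⟨i, hi, hFi⟩ := h₁ (max m₁ m₂) (le_max_left _ _)
  obtain ⟨j, hj, hGj⟩ := h₂ (max m₁ m₂) (le_max_right _ _)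
  obtain rfl := hi.unique hj
  exact ⟨(max m₁ m₂ : ℕ), _, hFi, hGj⟩

/-- Along any subsequence whose `n`-th term and all later subdivisions have mesh less than `ε_n`,
the natural maps form a level morphism. -/
lemma exists_natTrans (he_range : Set.range e = K.space) {t : ℕ → ℕ} (ht : StrictMono t)
    (hmesh : ∀ n, ∀ m ≥ t n, Clader.MeshLT K e m (S.ε n))
    {i : ∀ n, Clader.poset K (t n) →o SmallSubset (S.A n) (4 * S.ε n)}
    (hi : ∀ n, S.IsNaturalMap K e (i n)) :
    ∃ J : InvSystem.subsequence (Clader.hSequence K) ht ⟶ S.hSequence,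
      ∀ n, J.app (Opposite.op n) = S.hClass K (i n) := by
  refine ⟨NatTrans.ofOpSequence (F := InvSystem.subsequence (Clader.hSequence K) ht)
    (G := S.hSequence) (fun n => S.hClass K (i n)) fun n => ?_, fun n => rfl⟩
  have hle : t n ≤ t (n + 1) := ht.monotone n.le_succ
  obtain ⟨j, hj⟩ := S.exists_isNaturalMap he_range (hmesh n (t (n + 1)) hle)
  exact ((hi n).map_comp_hClass he_range hle (hmesh n) hj).trans
    (hj.hClass_comp_map (hmesh n _ hle) (hi (n + 1))).symm

end FASO

theorem mainTheorem6 {E X : Type u} [NormedAddCommGroup E] [NormedSpace ℝ E]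
    (K : Geometry.SimplicialComplex ℝ E) (hK : K.faces.Finite)
    [MetricSpace X] [CompactSpace X]
    (e : X → E) (he : Topology.IsEmbedding e) (he_range : Set.range e = K.space)
    (S : FASO X) :
    (∃! F : InvSystem.ofSequence (Clader.hSequence K) ⟶
        InvSystem.ofSequence S.hSequence, S.IsNaturalMorphism K e F) ∧
    ∃ (t : ℕ → ℕ) (ht : StrictMono t)
      (i : ∀ n, Clader.poset K (t n) →o SmallSubset (S.A n) (4 * S.ε n))
      (J : InvSystem.subsequence (Clader.hSequence K) ht ⟶ S.hSequence),
      (∀ n, S.IsNaturalMap K e (i n)) ∧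
      (∀ n, J.app (Opposite.op n) = S.hClass K (i n)) ∧
      S.IsNaturalMorphism K e
        (InvSystem.restriction (Clader.hSequence K) ht ≫ InvSystem.levelMorphism J) := by
  obtain ⟨t, ht, hmesh⟩ := Filter.extraction_forall_of_eventually'
    (P := fun n k => ∀ m ≥ k, Clader.MeshLT K e m (S.ε n)) fun n => by
      obtain ⟨m₀, h⟩ := Clader.exists_meshLT K hK he (S.ε_pos n)
      exact ⟨m₀, fun k hk m hm => h m (hk.trans hm)⟩
  choose i hi using fun n => S.exists_isNaturalMap he_range (hmesh n (t n) le_rfl)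
  obtain ⟨J, hJ⟩ := S.exists_natTrans he_range ht hmesh hi
  have hnat : S.IsNaturalMorphism K e
      (InvSystem.restriction (Clader.hSequence K) ht ≫ InvSystem.levelMorphism J) := by
    refine fun n => ⟨t n, fun m hm => ?_⟩
    obtain ⟨j, hj⟩ := S.exists_isNaturalMap he_range (hmesh n m hm)
    refine ⟨j, hj, InvSystem.represents_restriction_comp_levelMorphism ht J hm le_rfl _ ?_⟩
    refine ((congrArg _ (hJ n)).trans ((hi n).map_comp_hClass he_range hm (hmesh n) hj)).trans ?_
    exact ((congrArg (· ≫ S.hClass K j) ((Clader.hSequence K).map_id (Opposite.op m))).trans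
      (Category.id_comp _)).symm
  exact ⟨⟨_, hnat, fun F hF => hF.unique hnat⟩, t, ht, i, J, hi, hJ, hnat⟩
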